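/- Let $\alpha>0$ be rational, let $K\ge 1$ be an integer with $\beta=K\alpha\le 1$, let $A=\begin{pmatrix}a_1&a_2\\ b_1&b_2\end{pmatrix}$ be a real matrix and $z=(z_1,z_2)^\top\in\mathbb R^2$. Consider the mixed-index problem $$D_t^{\alpha}y_1=a_1y_1+a_2y_2,\qquad D_t^{\beta}y_2=b_1y_1+b_2y_2\quad(t>0),\qquad y(0)=z,$$ where $D_t^{\gamma}f(t)=\frac1{\Gamma(1-\gamma)}\int_0^t\frac{f'(s)}{(t-s)^{\gamma}}\,ds$ for $0<\gamma<1$ is the Caputo derivative, $D_t^1f=f'$, and a solution is a function $y:[0,\infty)\to\mathbb R^2$ that is absolutely continuous on every $[0,T]$ and for which both derivatives exist (for $\gamma<1$: the integral converges absolutely) and both equations hold at every $t>0$. Let $E_\alpha(x)=\sum_{j\ge0}x^j/\Gamma(1+j\alpha)$, and factorise over $\mathbb C$, with $w$ standing for $s^\alpha$, $$D(w)=w^{K+1}-a_1w^K-b_2w+\det A=\prod_{j=1}^{K+1}(w-\lambda_j).$$ Such a factorisation exists. Let $\lambda_1,\dots,\lambda_{K+1}$ be any such list of the roots with multiplicity,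 and consider the partial-fraction expansion $$\sum_{j=1}^{K+1}\frac{A_j}{w-\lambda_j}=\frac1{D(w)}\left(w^Kz+\begin{pmatrix}a_2\\-a_1\end{pmatrix}w^{K-1}z_2+\begin{pmatrix}-b_2\\b_1\end{pmatrix}z_1\right)\qquad(w\in\mathbb C,\ D(w)\ne0).\tag{$*$}$$ If the $\lambda_j$ are pairwise distinct, there is exactly one family of vectors $A_1,\dots,A_{K+1}\in\mathbb C^2$ satisfying $(*)$. Whenever vectors $A_j\in\mathbb C^2$ satisfy $(*)$ (whether or not the $\lambda_j$ are distinct), the mixed-index problem has exactly one solution on $[0,\infty)$, and it is $$y(t)=\sum_{j=1}^{K+1}A_j\,E_\alpha(\lambda_jt^\alpha),\qquad t\ge0.$$ -/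

import Mathlib

open Polynomial

noncomputable section

/-- The one-parameter Mittag-Leffler function `E_α(z) = ∑_{j ≥ 0} z ^ j / Γ(1 + j α)`
(the series converges for every complex `z` when `0 < α`). -/
def mittagLeffler (α : ℝ) (z : ℂ) : ℂ :=
  ∑' j : ℕ, z ^ j / ((Real.Gamma (1 + (j : ℝ) * α) : ℝ) : ℂ)

/-- The Caputo derivative of order `γ ∈ (0, 1]` with starting point `0`:
`(1 / Γ(1 - γ)) ∫_0^t f'(s) / (t - s) ^ γ ds` for `0 < γ < 1`, and `f'(t)` for `γ = 1`. -/
def caputoDeriv (γ : ℝ) (f : ℝ → ℝ) (t : ℝ) : ℝ :=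
  if γ = 1 then deriv f t
  else (1 / Real.Gamma (1 - γ)) * ∫ s in (0 : ℝ)..t, deriv f s / (t - s) ^ γ

/-- The Caputo derivative of order `γ` of `f` exists at `t`: the integral defining it converges
absolutely (for `γ < 1`), respectively `f` is differentiable at `t` (for `γ = 1`).
To be used together with local absolute continuity of `f`. -/
def CaputoDerivExists (γ : ℝ) (f : ℝ → ℝ) (t : ℝ) : Prop :=
  if γ = 1 then DifferentiableAt ℝ f t
  else IntervalIntegrable (fun s => deriv f s / (t - s) ^ γ) MeasureTheory.volume 0 t

/-- `y` solves on `[0, ∞)` the scalar mixed index-2 problem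
`D^{γ₀} y₀ = A₀₀ y₀ + A₀₁ y₁`, `D^{γ₁} y₁ = A₁₀ y₀ + A₁₁ y₁`, `y(0) = z`,
where both components are absolutely continuous on every `[0, T]`, and both Caputo derivatives
exist and satisfy the equation at every `t > 0`. -/
structure IsMixedIndexSolution (γ : Fin 2 → ℝ) (A : Matrix (Fin 2) (Fin 2) ℝ) (z : Fin 2 → ℝ)
    (y : ℝ → Fin 2 → ℝ) : Prop where
  initial : y 0 = z
  absolutelyContinuous :
    ∀ i, ∀ T : ℝ, 0 ≤ T → AbsolutelyContinuousOnInterval (fun t => y t i) 0 T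
  derivExists : ∀ i, ∀ t : ℝ, 0 < t → CaputoDerivExists (γ i) (fun s => y s i) t
  equation : ∀ i, ∀ t : ℝ, 0 < t → caputoDeriv (γ i) (fun s => y s i) t = A.mulVec (y t) i

/-- The polynomial `w ^ (K + 1) - a₁ w ^ K - b₂ w + det A` for `A = (a₁, a₂; b₁, b₂)`; it is
`Det(s) = s ^ (α + β) - a₁ s ^ β - b₂ s ^ α + det A` in the variable `w = s ^ α`
when `β = K α`. -/
def detPoly (A : Matrix (Fin 2) (Fin 2) ℝ) (K : ℕ) : ℂ[X] :=
  X ^ (K + 1) - C (A 0 0 : ℂ) * X ^ K - C (A 1 1 : ℂ) * X + C (A.det : ℂ)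

/-- `lam 0, …, lam K` are the roots of `detPoly A K`, listed with multiplicity. -/
def IsRootList (A : Matrix (Fin 2) (Fin 2) ℝ) (K : ℕ) (lam : Fin (K + 1) → ℂ) : Prop :=
  detPoly A K = ∏ j, (X - C (lam j))

/-- The partial fraction expansion, in the variable `w = s ^ α`, that the vectors `c j` satisfy:
`∑_j c_j / (w - λ_j)` equals
`(w ^ K z + w ^ (K - 1) z₁ (a₂, -a₁) + z₀ (-b₂, b₁)) / Det(w)`
for `A = (a₁, a₂; b₁, b₂)`, as rational functions of `w`, that is, at every `w` that is not a
root of the denominator. -/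
def IsPartialFraction (A : Matrix (Fin 2) (Fin 2) ℝ) (z : Fin 2 → ℝ) (K : ℕ)
    (lam : Fin (K + 1) → ℂ) (c : Fin (K + 1) → Fin 2 → ℂ) : Prop :=
  ∀ w : ℂ, (detPoly A K).eval w ≠ 0 →
    ∑ j, (1 / (w - lam j)) • c j =
      (1 / (detPoly A K).eval w) •
        ((w ^ K) • ![(z 0 : ℂ), (z 1 : ℂ)]
          + (w ^ (K - 1) * (z 1 : ℂ)) • ![(A 0 1 : ℂ), -(A 0 0 : ℂ)]
          + (z 0 : ℂ) • ![-(A 1 1 : ℂ), (A 1 0 : ℂ)])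

end

/-! Everything passes through the moments `m n i = ∑ j, c j i * lam j ^ n`. Summing the
Mittag-Leffler series over `j` gives `∑ n, m n i * t ^ (n α) / Γ(1 + n α)`, so the claimed solution
depends on the roots and coefficients only through their moments.

With `w = 1/u`, the expansion becomes an identity for the generating functions `M_i(u) = ∑ n, m n i
* u ^ n`: they solve `M₀ = z₀ + u (a₁ M₀ + a₂ M₁)`, `M₁ = z₁ + u ^ K (b₁ M₀ + b₂ M₁)`
(`generatingFunction_system`). Comparing coefficients gives recursions that make the moments real.
Since a Caputo derivative of order `k α` shifts such a series by `k` places, the same recursions are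
the two equations (`caputoDeriv_fracSeries_rpow`). Distinct roots are needed only to produce the
coefficients.

For uniqueness, an Abel integral of order `γ` inverts the Caputo derivative on absolutely continuous
functions (`sub_eq_integral_caputoDeriv`). The difference of two solutions then solves a homogeneous
Volterra system, and a sup norm weighted by `exp (-ρ t)` with large `ρ` forces it to vanish
(`eq_zero_of_abel_system`). -/

/-! ### Root lists and partial fractions -/

theorem Multiset.exists_eq_map_univ {α : Type*} {n : ℕ} (s : Multiset α) (hs : s.card = n) :
    ∃ f : Fin n → α, s = Finset.univ.val.map f := by
  subst hs
  induction s using Quotient.inductionOn with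
  | h l => exact ⟨l.get, (Fin.univ_val_map l.get).symm ▸ congrArg _ (List.ofFn_get l).symm⟩

theorem detPoly_monic_natDegree (A : Matrix (Fin 2) (Fin 2) ℝ) {K : ℕ} (hK : 0 < K) :
    (detPoly A K).Monic ∧ (detPoly A K).natDegree = K + 1 := by
  have h : detPoly A K = X ^ (K + 1) +
      (-C (A 0 0 : ℂ) * X ^ K - C (A 1 1 : ℂ) * X + C (A.det : ℂ)) := by
    rw [detPoly]; ring
  have hd : (-C (A 0 0 : ℂ) * X ^ K - C (A 1 1 : ℂ) * X + C (A.det : ℂ)).degree <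
      ((K + 1 : ℕ) : WithBot ℕ) := by
    refine lt_of_le_of_lt (b := ((K : ℕ) : WithBot ℕ)) ?_ (by exact_mod_cast Nat.lt_succ_self K)
    refine natDegree_le_iff_degree_le.mp ?_
    refine (natDegree_add_C).le.trans ((natDegree_sub_le _ _).trans (max_le ?_ ?_))
    · rw [← C_neg]
      exact natDegree_C_mul_X_pow_le _ _
    · exact (natDegree_C_mul_le _ _).trans (natDegree_X_le.trans hK)
  rw [h]
  refine ⟨monic_X_pow_add hd, ?_⟩
  rw [natDegree_add_eq_left_of_degree_lt (by rwa [degree_X_pow]), natDegree_X_pow]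

theorem exists_isRootList (A : Matrix (Fin 2) (Fin 2) ℝ) {K : ℕ} (hK : 0 < K) :
    ∃ lam : Fin (K + 1) → ℂ, IsRootList A K lam := by
  obtain ⟨hm, hdeg⟩ := detPoly_monic_natDegree A hK
  have hs := IsAlgClosed.splits (detPoly A K)
  obtain ⟨f, hf⟩ := Multiset.exists_eq_map_univ (detPoly A K).roots
    (n := K + 1) (by rw [← hdeg]; exact hs.natDegree_eq_card_roots.symm)
  refine ⟨f, ?_⟩
  rw [IsRootList, hs.eq_prod_roots_of_monic hm, hf, Multiset.map_map]
  rfl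

/-- The numerators of the two components of the rational function expanded in
`IsPartialFraction`. -/
noncomputable def partialFractionNumerator (A : Matrix (Fin 2) (Fin 2) ℝ) (z : Fin 2 → ℝ) (K : ℕ) :
    Fin 2 → ℂ[X] :=
  ![C (z 0 : ℂ) * X ^ K + C ((z 1 : ℂ) * (A 0 1 : ℂ)) * X ^ (K - 1) - C ((z 0 : ℂ) * (A 1 1 : ℂ)),
    C (z 1 : ℂ) * X ^ K - C ((z 1 : ℂ) * (A 0 0 : ℂ)) * X ^ (K - 1) + C ((z 0 : ℂ) * (A 1 0 : ℂ))]

theorem natDegree_partialFractionNumerator_le (A : Matrix (Fin 2) (Fin 2) ℝ) (z : Fin 2 → ℝ)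
    (K : ℕ) (i : Fin 2) : (partialFractionNumerator A z K i).natDegree ≤ K := by
  have h1 : ∀ a : ℂ, (C a * X ^ (K - 1)).natDegree ≤ K := fun a =>
    (natDegree_C_mul_X_pow_le _ _).trans (Nat.sub_le _ _)
  fin_cases i
  · refine (natDegree_sub_le _ _).trans (max_le ((natDegree_add_le _ _).trans (max_le ?_ (h1 _))) ?_)
    · exact natDegree_C_mul_X_pow_le _ _
    · exact (natDegree_C _).le.trans (Nat.zero_le _)
  · refine (natDegree_add_le _ _).trans (max_le ((natDegree_sub_le _ _).trans (max_le ?_ (h1 _))) ?_)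
    · exact natDegree_C_mul_X_pow_le _ _
    · exact (natDegree_C _).le.trans (Nat.zero_le _)

theorem isPartialFraction_iff_forall_sum_eq_div {A : Matrix (Fin 2) (Fin 2) ℝ} {z : Fin 2 → ℝ}
    {K : ℕ} {lam : Fin (K + 1) → ℂ} {c : Fin (K + 1) → Fin 2 → ℂ} :
    IsPartialFraction A z K lam c ↔ ∀ i, ∀ w : ℂ, (detPoly A K).eval w ≠ 0 →
      ∑ j, c j i / (w - lam j) =
        (partialFractionNumerator A z K i).eval w / (detPoly A K).eval w := by
  rw [forall_comm]
  refine forall_congr' fun w => ?_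
  rw [forall_comm]
  refine forall_congr' fun hw => ?_
  rw [funext_iff]
  refine forall_congr' fun i => ?_
  refine Eq.congr ?_ ?_
  · simp [Finset.sum_apply, div_eq_inv_mul]
  · fin_cases i <;> simp [partialFractionNumerator] <;> ring

/-- `R * (P - Q)` vanishes everywhere. This upgrades identities known only off the poles to
polynomial identities. -/
theorem Polynomial.eq_of_eval_eq_of_eval_ne_zero {P Q R : ℂ[X]} (hR : R ≠ 0)
    (h : ∀ w, R.eval w ≠ 0 → P.eval w = Q.eval w) : P = Q := by
  have : R * (P - Q) = 0 := by
    refine Polynomial.funext fun w => ?_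
    by_cases hw : R.eval w = 0
    · simp [hw]
    · simp [h w hw]
  rcases mul_eq_zero.mp this with h | h
  · exact absurd h hR
  · exact sub_eq_zero.mp h

namespace IsRootList

variable {A : Matrix (Fin 2) (Fin 2) ℝ} {z : Fin 2 → ℝ} {K : ℕ} {lam : Fin (K + 1) → ℂ}
  {c : Fin (K + 1) → Fin 2 → ℂ}

theorem eval_detPoly (h : IsRootList A K lam) (w : ℂ) :
    (detPoly A K).eval w = ∏ j, (w - lam j) := by
  rw [h]; simp [eval_prod]

theorem detPoly_ne_zero (h : IsRootList A K lam) : detPoly A K ≠ 0 := by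
  rw [h]
  exact (monic_prod_of_monic _ _ fun j _ => monic_X_sub_C _).ne_zero

theorem sum_prod_erase_eq (h : IsRootList A K lam) (hc : IsPartialFraction A z K lam c)
    (i : Fin 2) :
    ∑ j, C (c j i) * ∏ k ∈ Finset.univ.erase j, (X - C (lam k)) =
      partialFractionNumerator A z K i := by
  refine Polynomial.eq_of_eval_eq_of_eval_ne_zero h.detPoly_ne_zero fun w hw => ?_
  have h1 := isPartialFraction_iff_forall_sum_eq_div.mp hc i w hw
  rw [eq_div_iff hw, Finset.sum_mul] at h1
  rw [← h1]
  simp only [eval_finsetSum, eval_mul, eval_C, eval_prod, eval_sub, eval_X]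
  refine Finset.sum_congr rfl fun j _ => ?_
  rw [h.eval_detPoly] at hw ⊢
  rw [← Finset.mul_prod_erase _ _ (Finset.mem_univ j)]
  have : w - lam j ≠ 0 := Finset.prod_ne_zero_iff.mp hw j (Finset.mem_univ j)
  field_simp

/-- Existence is the barycentric Lagrange formula: the numerator has degree at most `K`, so it is
its own interpolant at the `K + 1` roots. Uniqueness evaluates the identity cleared of denominators
at each root. -/
theorem existsUnique_isPartialFraction (h : IsRootList A K lam) (hinj : Function.Injective lam) :
    ∃! c : Fin (K + 1) → Fin 2 → ℂ, IsPartialFraction A z K lam c := by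
  refine existsUnique_of_exists_of_unique
    ⟨fun j i => Lagrange.nodalWeight Finset.univ lam j *
      (partialFractionNumerator A z K i).eval (lam j), ?_⟩ ?_
  · rw [isPartialFraction_iff_forall_sum_eq_div]
    intro i w hw
    have hdeg : (partialFractionNumerator A z K i).degree <
        ((Finset.univ : Finset (Fin (K + 1))).card : WithBot ℕ) := by
      refine (natDegree_le_iff_degree_le.mp
        (natDegree_partialFractionNumerator_le A z K i)).trans_lt ?_
      rw [Finset.card_univ, Fintype.card_fin]
      exact_mod_cast Nat.lt_succ_self K
    have hne : ∀ j ∈ Finset.univ, w ≠ lam j := fun j hj hwj => by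
      rw [h.eval_detPoly] at hw
      exact Finset.prod_ne_zero_iff.mp hw j hj (sub_eq_zero.mpr hwj)
    have h1 := Lagrange.eq_interpolate (v := lam) (hinj.injOn) hdeg
    have h2 := (congrArg (eval w) h1).trans (Lagrange.eval_interpolate_not_at_node _ hne)
    rw [h2, Lagrange.nodal_eq, ← h, mul_div_cancel_left₀ _ hw]
    exact Finset.sum_congr rfl fun j _ => by ring
  · intro c d hc hd
    funext j i
    have h1 := congrArg (eval (lam j)) ((h.sum_prod_erase_eq hc i).trans
      (h.sum_prod_erase_eq hd i).symm)
    -- At `lam j` every summand other than the `j`-th contains the factor `lam j - lam j`.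
    have h2 : ∀ e : Fin (K + 1) → Fin 2 → ℂ,
        eval (lam j) (∑ j, C (e j i) * ∏ k ∈ Finset.univ.erase j, (X - C (lam k))) =
          e j i * ∏ k ∈ Finset.univ.erase j, (lam j - lam k) := fun e => by
      simp only [eval_finsetSum, eval_mul, eval_C, eval_prod, eval_sub, eval_X]
      refine Finset.sum_eq_single j (fun k _ hk => ?_) (by simp)
      rw [Finset.prod_eq_zero (Finset.mem_erase.mpr ⟨hk.symm, Finset.mem_univ j⟩) (sub_self _),
        mul_zero]
    rw [h2, h2] at h1
    refine mul_right_cancel₀ (Finset.prod_ne_zero_iff.mpr fun k hk => ?_) h1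
    exact sub_ne_zero.mpr fun hjk => (Finset.mem_erase.mp hk).1 (hinj hjk).symm

/-! ### Reversed polynomials and the recursion for the moments -/

/-- Substitute `w = 1/u` in the factorisation and multiply by `u ^ (K + 1)`. -/
theorem prod_one_sub_eq (h : IsRootList A K lam) :
    ∏ j, (1 - C (lam j) * X) =
      1 - C (A 0 0 : ℂ) * X - C (A 1 1 : ℂ) * X ^ K + C (A.det : ℂ) * X ^ (K + 1) := by
  refine Polynomial.eq_of_eval_eq_of_eval_ne_zero X_ne_zero fun u hu => ?_
  have hu : u ≠ 0 := by simpa using hu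
  have h1 := h.eval_detPoly u⁻¹
  have h2 : (∏ j, (u⁻¹ - lam j)) * u ^ (K + 1) = ∏ j, (1 - lam j * u) := by
    have : u ^ (K + 1) = ∏ j : Fin (K + 1), u := by simp
    rw [this, ← Finset.prod_mul_distrib]
    exact Finset.prod_congr rfl fun j _ => by field_simp
  simp only [eval_prod, eval_sub, eval_add, eval_mul, eval_pow, eval_C, eval_X, eval_one]
  rw [← h2, ← h1, detPoly]
  simp only [eval_sub, eval_add, eval_mul, eval_pow, eval_C, eval_X, inv_pow, pow_succ]
  field_simp

theorem sum_prod_erase_one_sub_eq (h : IsRootList A K lam) (hK : 0 < K)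
    (hc : IsPartialFraction A z K lam c) (i : Fin 2) :
    ∑ j, C (c j i) * ∏ k ∈ Finset.univ.erase j, (1 - C (lam k) * X) =
      (![C (z 0 : ℂ) + C ((z 1 : ℂ) * (A 0 1 : ℂ)) * X - C ((z 0 : ℂ) * (A 1 1 : ℂ)) * X ^ K,
        C (z 1 : ℂ) - C ((z 1 : ℂ) * (A 0 0 : ℂ)) * X + C ((z 0 : ℂ) * (A 1 0 : ℂ)) * X ^ K] :
        Fin 2 → ℂ[X]) i := by
  refine Polynomial.eq_of_eval_eq_of_eval_ne_zero X_ne_zero fun u hu => ?_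
  have hu : u ≠ 0 := by simpa using hu
  have h1 := congrArg (fun p => eval u⁻¹ p * u ^ K) (h.sum_prod_erase_eq hc i)
  simp only [eval_finsetSum, eval_mul, eval_C, eval_prod, eval_sub, eval_X, Finset.sum_mul] at h1
  have h2 : ∀ j, (∏ k ∈ Finset.univ.erase j, (u⁻¹ - lam k)) * u ^ K =
      ∏ k ∈ Finset.univ.erase j, (1 - lam k * u) := fun j => by
    have : u ^ K = ∏ k ∈ Finset.univ.erase j, u := by simp
    rw [this, ← Finset.prod_mul_distrib]
    exact Finset.prod_congr rfl fun j _ => by field_simp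
  simp only [mul_assoc, h2] at h1
  simp only [eval_finsetSum, eval_mul, eval_C, eval_prod, eval_sub, eval_X, eval_one]
  rw [h1]
  -- Writing `K = k + 1` removes the truncated subtraction in `X ^ (K - 1)`.
  obtain ⟨k, rfl⟩ := Nat.exists_eq_add_one.mpr hK
  fin_cases i
  · simp only [partialFractionNumerator, Fin.zero_eta, Matrix.cons_val_zero, eval_sub, eval_add,
      eval_mul, eval_pow, eval_C, eval_X, Nat.add_sub_cancel]
    simp only [inv_pow, pow_succ]
    field_simp
  · simp only [partialFractionNumerator, Fin.mk_one, Matrix.cons_val_one, Matrix.cons_val_fin_one,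
      eval_sub, eval_add, eval_mul, eval_pow, eval_C, eval_X, Nat.add_sub_cancel]
    simp only [inv_pow, pow_succ]
    field_simp

end IsRootList

theorem PowerSeries.mk_pow_mul_one_sub {R : Type*} [CommRing R] (a : R) :
    PowerSeries.mk (fun n => a ^ n) * (1 - PowerSeries.C a * PowerSeries.X) = 1 := by
  ext n
  rw [mul_sub, mul_one, mul_left_comm, map_sub, PowerSeries.coeff_C_mul, PowerSeries.coeff_one]
  cases n with
  | zero => simp
  | succ n =>
    rw [PowerSeries.coeff_succ_mul_X, PowerSeries.coeff_mk, PowerSeries.coeff_mk, pow_succ']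
    simp

namespace IsRootList

variable {A : Matrix (Fin 2) (Fin 2) ℝ} {z : Fin 2 → ℝ} {K : ℕ} {lam : Fin (K + 1) → ℂ}
  {c : Fin (K + 1) → Fin 2 → ℂ}

/-- By the geometric series, the generating function of the moments is `∑ j, c j i / (1 - lam j X)`;
the product clears its denominators. -/
theorem prod_one_sub_mul_mk (i : Fin 2) :
    ((∏ j, (1 - C (lam j) * X) : ℂ[X]) : PowerSeries ℂ) *
        PowerSeries.mk (fun n => ∑ j, c j i * lam j ^ n) =
      ((∑ j, C (c j i) * ∏ k ∈ Finset.univ.erase j, (1 - C (lam k) * X) : ℂ[X]) :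
        PowerSeries ℂ) := by
  have h1 : PowerSeries.mk (fun n => ∑ j, c j i * lam j ^ n) =
      ∑ j, PowerSeries.C (c j i) * PowerSeries.mk (fun n => lam j ^ n) := by
    ext n
    simp
  rw [h1, Finset.mul_sum, ← Polynomial.coeToPowerSeries.ringHom_apply,
    ← Polynomial.coeToPowerSeries.ringHom_apply, map_sum]
  refine Finset.sum_congr rfl fun j _ => ?_
  rw [← Finset.mul_prod_erase _ _ (Finset.mem_univ j), map_mul, map_mul]
  have h2 := PowerSeries.mk_pow_mul_one_sub (lam j)
  simp only [Polynomial.coeToPowerSeries.ringHom_apply, Polynomial.coe_sub, Polynomial.coe_one,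
    Polynomial.coe_mul, Polynomial.coe_C, Polynomial.coe_X]
  linear_combination (PowerSeries.C (c j i) *
    ((∏ k ∈ Finset.univ.erase j, (1 - C (lam k) * X) : ℂ[X]) : PowerSeries ℂ)) * h2

/-- The generating functions of the moments `∑ j, c j i * lam j ^ n` solve the linear system of
the Laplace transformed problem. -/
theorem generatingFunction_system (h : IsRootList A K lam) (hK : 0 < K)
    (hc : IsPartialFraction A z K lam c) :
    (PowerSeries.mk (fun n => ∑ j, c j 0 * lam j ^ n) =
      PowerSeries.C (z 0 : ℂ) + PowerSeries.X *
        (PowerSeries.C (A 0 0 : ℂ) * PowerSeries.mk (fun n => ∑ j, c j 0 * lam j ^ n) +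
          PowerSeries.C (A 0 1 : ℂ) * PowerSeries.mk (fun n => ∑ j, c j 1 * lam j ^ n))) ∧
    (PowerSeries.mk (fun n => ∑ j, c j 1 * lam j ^ n) =
      PowerSeries.C (z 1 : ℂ) + PowerSeries.X ^ K *
        (PowerSeries.C (A 1 0 : ℂ) * PowerSeries.mk (fun n => ∑ j, c j 0 * lam j ^ n) +
          PowerSeries.C (A 1 1 : ℂ) * PowerSeries.mk (fun n => ∑ j, c j 1 * lam j ^ n))) := by
  set M0 := PowerSeries.mk (fun n => ∑ j, c j 0 * lam j ^ n) with hM0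
  set M1 := PowerSeries.mk (fun n => ∑ j, c j 1 * lam j ^ n) with hM1
  have h0 := prod_one_sub_mul_mk (lam := lam) (c := c) 0
  have h1 := prod_one_sub_mul_mk (lam := lam) (c := c) 1
  rw [← hM0, h.sum_prod_erase_one_sub_eq hK hc] at h0
  rw [← hM1, h.sum_prod_erase_one_sub_eq hK hc] at h1
  have hD : ((∏ j, (1 - C (lam j) * X) : ℂ[X]) : PowerSeries ℂ) ≠ 0 := by
    rw [Ne, Polynomial.coe_eq_zero_iff]
    intro h0
    have := congrArg (eval 0) h0
    simp [eval_prod] at this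
  have hDe : ((∏ j, (1 - C (lam j) * X) : ℂ[X]) : PowerSeries ℂ) = _ :=
    congrArg _ h.prod_one_sub_eq
  set D := ((∏ j, (1 - C (lam j) * X) : ℂ[X]) : PowerSeries ℂ)
  rw [Matrix.det_fin_two] at hDe
  simp only [Matrix.cons_val_zero, Matrix.cons_val_one, Matrix.cons_val_fin_one,
    Polynomial.coe_sub, Polynomial.coe_add, Polynomial.coe_one, Polynomial.coe_mul,
    Polynomial.coe_pow, Polynomial.coe_C, Polynomial.coe_X, Complex.ofReal_sub, Complex.ofReal_mul,
    map_sub, map_mul] at h0 h1 hDe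
  constructor
  -- Cramer's rule: `D` is the determinant `(1 - a₁ X)(1 - b₂ X ^ K) - a₂ b₁ X ^ (K + 1)` of the
  -- linear system.
  · refine mul_left_cancel₀ hD ?_
    linear_combination (1 - PowerSeries.X * PowerSeries.C (A 0 0 : ℂ)) * h0 -
      (PowerSeries.X * PowerSeries.C (A 0 1 : ℂ)) * h1 - PowerSeries.C (z 0 : ℂ) * hDe
  · refine mul_left_cancel₀ hD ?_
    linear_combination (1 - PowerSeries.X ^ K * PowerSeries.C (A 1 1 : ℂ)) * h1 -
      (PowerSeries.X ^ K * PowerSeries.C (A 1 0 : ℂ)) * h0 - PowerSeries.C (z 1 : ℂ) * hDe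

theorem moment_fst_zero (h : IsRootList A K lam) (hK : 0 < K)
    (hc : IsPartialFraction A z K lam c) : ∑ j, c j 0 * lam j ^ 0 = z 0 := by
  have := congrArg (PowerSeries.coeff 0) (h.generatingFunction_system hK hc).1
  rw [map_add, PowerSeries.coeff_zero_X_mul, PowerSeries.coeff_mk] at this
  simpa using this

theorem moment_fst_succ (h : IsRootList A K lam) (hK : 0 < K)
    (hc : IsPartialFraction A z K lam c) (n : ℕ) :
    ∑ j, c j 0 * lam j ^ (n + 1) =
      A 0 0 * ∑ j, c j 0 * lam j ^ n + A 0 1 * ∑ j, c j 1 * lam j ^ n := by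
  have := congrArg (PowerSeries.coeff (n + 1)) (h.generatingFunction_system hK hc).1
  rw [map_add, PowerSeries.coeff_succ_X_mul, map_add, PowerSeries.coeff_C_mul,
    PowerSeries.coeff_C_mul, PowerSeries.coeff_mk, PowerSeries.coeff_mk, PowerSeries.coeff_mk,
    PowerSeries.coeff_C, if_neg n.succ_ne_zero, zero_add] at this
  exact this

/-- The vanishing moments remove the powers `t ^ (n α)` with `0 < n < K`, whose derivative of order
`K α` would be a negative power of `t`. -/
theorem moment_snd_of_lt (h : IsRootList A K lam) (hK : 0 < K)
    (hc : IsPartialFraction A z K lam c) {n : ℕ} (hn : n < K) :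
    ∑ j, c j 1 * lam j ^ n = if n = 0 then (z 1 : ℂ) else 0 := by
  have := congrArg (PowerSeries.coeff n) (h.generatingFunction_system hK hc).2
  rw [map_add, PowerSeries.coeff_X_pow_mul', if_neg (by omega), PowerSeries.coeff_mk,
    PowerSeries.coeff_C, add_zero] at this
  exact this

theorem moment_snd_add (h : IsRootList A K lam) (hK : 0 < K)
    (hc : IsPartialFraction A z K lam c) (n : ℕ) :
    ∑ j, c j 1 * lam j ^ (n + K) =
      A 1 0 * ∑ j, c j 0 * lam j ^ n + A 1 1 * ∑ j, c j 1 * lam j ^ n := by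
  have := congrArg (PowerSeries.coeff (n + K)) (h.generatingFunction_system hK hc).2
  rw [map_add, PowerSeries.coeff_X_pow_mul, map_add, PowerSeries.coeff_C_mul,
    PowerSeries.coeff_C_mul, PowerSeries.coeff_mk, PowerSeries.coeff_mk, PowerSeries.coeff_mk,
    PowerSeries.coeff_C, if_neg (by omega), zero_add] at this
  exact this

/-- The moments are real. -/
theorem exists_real_moment (h : IsRootList A K lam) (hK : 0 < K)
    (hc : IsPartialFraction A z K lam c) (n : ℕ) :
    ∃ x : Fin 2 → ℝ, ∀ i, ∑ j, c j i * lam j ^ n = (x i : ℂ) := by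
  suffices H : (∃ x : ℝ, ∑ j, c j 0 * lam j ^ n = (x : ℂ)) ∧
      ∃ x : ℝ, ∑ j, c j 1 * lam j ^ n = (x : ℂ) by
    obtain ⟨⟨x, hx⟩, y, hy⟩ := H
    exact ⟨![x, y], fun i => by fin_cases i <;> simpa⟩
  induction n using Nat.strong_induction_on with
  | _ n ih =>
    constructor
    · cases n with
      | zero => exact ⟨z 0, h.moment_fst_zero hK hc⟩
      | succ n =>
        obtain ⟨⟨x, hx⟩, y, hy⟩ := ih n n.lt_succ_self
        exact ⟨A 0 0 * x + A 0 1 * y, by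
          rw [h.moment_fst_succ hK hc, hx, hy]; push_cast; ring⟩
    · rcases lt_or_ge n K with hn | hn
      · exact ⟨if n = 0 then z 1 else 0, by
          rw [h.moment_snd_of_lt hK hc hn]; split_ifs <;> simp⟩
      · obtain ⟨m, rfl⟩ := Nat.exists_eq_add_of_le' hn
        obtain ⟨⟨x, hx⟩, y, hy⟩ := ih m (by omega)
        exact ⟨A 1 0 * x + A 1 1 * y, by
          rw [h.moment_snd_add hK hc, hx, hy]; push_cast; ring⟩

end IsRootList

/-! ### Convergence and differentiation of Mittag-Leffler type series -/

open MeasureTheory in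
-- Keep only the part of Euler's integral over `(M, M + 1]`, where `x ^ y ≥ M ^ y`. As `M` is
-- arbitrary, `Γ` outgrows every exponential.
theorem Real.exists_mul_rpow_le_Gamma {M : ℝ} (hM : 0 < M) :
    ∃ c > 0, ∀ y : ℝ, 0 < y → c * M ^ y ≤ Real.Gamma y := by
  refine ⟨Real.exp (-(M + 1)) / (M + 1), by positivity, fun y hy => ?_⟩
  rw [Real.Gamma_eq_integral hy]
  have hint := Real.GammaIntegral_convergent hy
  have hsub : Set.Ioc M (M + 1) ⊆ Set.Ioi 0 := fun x hx => hM.trans hx.1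
  calc Real.exp (-(M + 1)) / (M + 1) * M ^ y
      = ∫ _ in Set.Ioc M (M + 1), Real.exp (-(M + 1)) / (M + 1) * M ^ y := by simp
    _ ≤ ∫ x in Set.Ioc M (M + 1), Real.exp (-x) * x ^ (y - 1) := by
        refine setIntegral_mono_on (integrableOn_const (by simp)) (hint.mono_set hsub) measurableSet_Ioc fun x hx => ?_
        have hx0 : 0 < x := hM.trans hx.1
        rw [Real.rpow_sub_one hx0.ne', div_mul_eq_mul_div, mul_div_assoc]
        have h1 : M ^ y ≤ x ^ y := Real.rpow_le_rpow hM.le hx.1.le hy.le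
        have h2 : Real.exp (-(M + 1)) ≤ Real.exp (-x) := Real.exp_le_exp.mpr (by linarith [hx.2])
        have h3 : x ≤ M + 1 := hx.2
        gcongr
    _ ≤ ∫ x in Set.Ioi 0, Real.exp (-x) * x ^ (y - 1) := by
        refine setIntegral_mono_set hint ?_ (Filter.Eventually.of_forall hsub)
        filter_upwards [ae_restrict_mem measurableSet_Ioi] with x hx
        have : (0 : ℝ) < x := hx
        simp only [Pi.zero_apply]
        positivity

/-- A sequence that grows at most geometrically. -/
def GeometricallyBounded (m : ℕ → ℝ) : Prop :=
  ∃ C R : ℝ, 0 ≤ C ∧ 0 ≤ R ∧ ∀ n, |m n| ≤ C * R ^ n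

theorem GeometricallyBounded.shift {m : ℕ → ℝ} (hm : GeometricallyBounded m) (k : ℕ) :
    GeometricallyBounded fun n => m (n + k) := by
  obtain ⟨C, R, hC, hR, h⟩ := hm
  refine ⟨C * R ^ k, R, by positivity, hR, fun n => (h _).trans_eq ?_⟩
  ring

/-- The series `∑ mₙ xⁿ / Γ(n α + δ)`, of Mittag-Leffler type. -/
noncomputable def fracSeries (α δ : ℝ) (m : ℕ → ℝ) (x : ℝ) : ℝ :=
  ∑' n : ℕ, m n * x ^ n / Real.Gamma (n * α + δ)

section fracSeries

variable {α δ : ℝ} {m : ℕ → ℝ}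

theorem summable_norm_fracSeries (hα : 0 < α) (hδ : 0 < δ) (hm : GeometricallyBounded m) (x : ℝ) :
    Summable fun n : ℕ => ‖m n * x ^ n / Real.Gamma (n * α + δ)‖ := by
  obtain ⟨C, R, hC, hR, h⟩ := hm
  set q : ℝ := 2 * (R * |x| + 1) with hq
  have hq0 : 0 < q := by positivity
  -- The base `q ^ α⁻¹` gives `Γ(n α + δ)` a lower bound of order `q ^ n`, with `q > R |x|`, hence a
  -- geometric majorant.
  obtain ⟨c, hc, hcG⟩ := Real.exists_mul_rpow_le_Gamma (M := q ^ α⁻¹) (by positivity)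
  have hr : R * |x| / q < 1 := by
    rw [div_lt_one hq0, hq]
    have : 0 ≤ R * |x| := by positivity
    linarith
  refine Summable.of_nonneg_of_le (fun n => norm_nonneg _) (fun n => ?_)
    ((summable_geometric_of_lt_one (by positivity) hr).mul_left (C / (c * (q ^ α⁻¹) ^ δ)))
  have hpos : 0 < n * α + δ := by positivity
  have h1 := hcG _ hpos
  have h2 : (q ^ α⁻¹) ^ (n * α + δ) = q ^ n * (q ^ α⁻¹) ^ δ := by
    rw [Real.rpow_add (by positivity), ← Real.rpow_mul hq0.le, mul_comm (n : ℝ) α, ← mul_assoc,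
      inv_mul_cancel₀ hα.ne', one_mul, Real.rpow_natCast]
  rw [h2] at h1
  rw [norm_div, norm_mul, norm_pow, Real.norm_eq_abs, Real.norm_eq_abs, Real.norm_eq_abs,
    abs_of_pos (Real.Gamma_pos_of_pos hpos)]
  calc |m n| * |x| ^ n / Real.Gamma (n * α + δ)
      ≤ C * R ^ n * |x| ^ n / (c * (q ^ n * (q ^ α⁻¹) ^ δ)) := by
        have := h n
        gcongr
    _ = C / (c * (q ^ α⁻¹) ^ δ) * (R * |x| / q) ^ n := by
        rw [div_pow]
        field_simp
        rw [mul_pow]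
        ring

theorem summable_fracSeries (hα : 0 < α) (hδ : 0 < δ) (hm : GeometricallyBounded m) (x : ℝ) :
    Summable fun n : ℕ => m n * x ^ n / Real.Gamma (n * α + δ) :=
  (summable_norm_fracSeries hα hδ hm x).of_norm

theorem continuous_fracSeries (hα : 0 < α) (hδ : 0 < δ) (hm : GeometricallyBounded m) :
    Continuous (fracSeries α δ m) := by
  rw [continuous_iff_continuousAt]
  intro x
  have h : ContinuousOn (fracSeries α δ m) (Metric.ball 0 (|x| + 1)) := by
    refine continuousOn_tsum (fun n => by fun_prop)
      (summable_norm_fracSeries hα hδ hm (|x| + 1)) fun n y hy => ?_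
    rw [mem_ball_zero_iff] at hy
    rw [norm_div, norm_div, norm_mul, norm_mul, norm_pow, norm_pow]
    have : ‖y‖ ≤ ‖|x| + 1‖ := hy.le.trans (Real.le_norm_self _)
    gcongr
  refine h.continuousAt (Metric.isOpen_ball.mem_nhds ?_)
  rw [mem_ball_zero_iff, Real.norm_eq_abs]
  linarith

/-- `Γ(s + 1) = s Γ(s)` at `s = (n + 1) α` absorbs the factor `n + 1`, up to `α`. -/
theorem fracSeries_deriv_term (hα : 0 < α) (n : ℕ) (x : ℝ) :
    m (n + 1) * (((n + 1 : ℕ) : ℝ) * x ^ n) / Real.Gamma (((n + 1 : ℕ) : ℝ) * α + 1) =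
      m (n + 1) * x ^ n / Real.Gamma (n * α + α) / α := by
  have h1 : ((n + 1 : ℕ) : ℝ) * α = n * α + α := by push_cast; ring
  have h2 : (0 : ℝ) < n * α + α := by positivity
  have h3 := Real.Gamma_pos_of_pos h2
  rw [Real.Gamma_add_one (by rw [h1]; exact h2.ne'), h1]
  have h4 : ((n + 1 : ℕ) : ℝ) = (n * α + α) / α := by rw [← h1]; field_simp
  rw [h4]
  field_simp

theorem hasDerivAt_fracSeries (hα : 0 < α) (hm : GeometricallyBounded m) (x : ℝ) :
    HasDerivAt (fracSeries α 1 m) (fracSeries α α (fun n => m (n + 1)) x / α) x := by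
  set g' : ℕ → ℝ → ℝ := fun n y => m n * (n * y ^ (n - 1)) / Real.Gamma (n * α + 1) with hg'
  set r : ℝ := |x| + 1 with hr
  have hterm : ∀ n y, g' (n + 1) y = m (n + 1) * y ^ n / Real.Gamma (n * α + α) / α := fun n y =>
    fracSeries_deriv_term hα n y
  have hs : ∀ y, Summable fun n => ‖g' n y‖ := fun y => by
    rw [← summable_nat_add_iff 1]
    simp only [hterm, norm_div _ α]
    exact (summable_norm_fracSeries hα hα (hm.shift 1) y).div_const _
  have key : HasDerivAt (fracSeries α 1 m) (∑' n, g' n x) x := by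
    refine hasDerivAt_tsum_of_isPreconnected (t := Metric.ball (0 : ℝ) r) (hs r)
      Metric.isOpen_ball (convex_ball _ _).isPreconnected (fun n y _ => ?_) (fun n y hy => ?_)
      (y₀ := x) ?_ (summable_fracSeries hα one_pos hm x) ?_
    · exact ((hasDerivAt_pow n y).const_mul (m n)).div_const _
    · rw [mem_ball_zero_iff] at hy
      simp only [hg']
      rw [norm_div, norm_div, norm_mul, norm_mul, norm_mul, norm_mul, norm_pow, norm_pow]
      have : ‖y‖ ≤ ‖r‖ := hy.le.trans (Real.le_norm_self _)
      gcongr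
    all_goals
      rw [mem_ball_zero_iff, Real.norm_eq_abs]
      linarith
  have h0 : g' 0 x = 0 := by simp [hg']
  rw [(hs x).of_norm.tsum_eq_zero_add, h0, zero_add] at key
  simp only [hterm] at key
  rwa [tsum_div_const] at key

/-- The extracted power `x ^ k` later cancels the factor `t ^ (α - K α)` in the Caputo derivative of
order `K α`. -/
theorem fracSeries_eq_pow_mul (hα : 0 < α) (hδ : 0 < δ) (hm : GeometricallyBounded m) {k : ℕ}
    (h : ∀ n < k, m n = 0) (x : ℝ) :
    fracSeries α δ m x = x ^ k * fracSeries α (δ + k * α) (fun n => m (n + k)) x := by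
  rw [fracSeries, ← (summable_fracSeries hα hδ hm x).sum_add_tsum_nat_add k,
    Finset.sum_eq_zero fun n hn => by rw [h n (Finset.mem_range.mp hn)]; simp, zero_add,
    fracSeries, ← tsum_mul_left]
  refine tsum_congr fun n => ?_
  have : ((n + k : ℕ) : ℝ) * α + δ = n * α + (δ + k * α) := by push_cast; ring
  rw [this, pow_add]
  ring

theorem fracSeries_add_mul (hα : 0 < α) (hδ : 0 < δ) {m' : ℕ → ℝ} (hm : GeometricallyBounded m)
    (hm' : GeometricallyBounded m') (a b x : ℝ) :
    fracSeries α δ (fun n => a * m n + b * m' n) x =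
      a * fracSeries α δ m x + b * fracSeries α δ m' x := by
  rw [fracSeries, fracSeries, fracSeries, ← tsum_mul_left, ← tsum_mul_left,
    ← ((summable_fracSeries hα hδ hm x).mul_left a).tsum_add
      ((summable_fracSeries hα hδ hm' x).mul_left b)]
  exact tsum_congr fun n => by ring

end fracSeries

/-! ### Beta integrals and Caputo derivatives of the series -/

open MeasureTheory in
theorem integral_rpow_mul_sub_rpow {a b t : ℝ} (ha : 0 < a) (hb : 0 < b) (ht : 0 < t) :
    ∫ s in (0 : ℝ)..t, s ^ (a - 1) * (t - s) ^ (b - 1) =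
      t ^ (a + b - 1) * (Real.Gamma a * Real.Gamma b / Real.Gamma (a + b)) := by
  have h := Complex.betaIntegral_scaled a b ht
  rw [Complex.betaIntegral_eq_Gamma_mul_div _ _ (by simpa) (by simpa)] at h
  rw [← Complex.ofReal_inj, ← intervalIntegral.integral_ofReal]
  refine Eq.trans (intervalIntegral.integral_congr fun s hs => ?_) (h.trans ?_)
  · rw [Set.uIcc_of_le ht.le] at hs
    rw [Complex.ofReal_mul, Complex.ofReal_cpow hs.1, Complex.ofReal_cpow (sub_nonneg.mpr hs.2)]
    push_cast
    rfl
  · rw [Complex.ofReal_mul, Complex.ofReal_cpow ht.le, ← Complex.ofReal_add]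
    simp only [Complex.Gamma_ofReal]
    push_cast
    rfl

theorem intervalIntegrable_rpow_mul_sub_rpow {a b t : ℝ} (ha : 0 < a) (hb : 0 < b) (ht : 0 < t) :
    IntervalIntegrable (fun s : ℝ => s ^ (a - 1) * (t - s) ^ (b - 1)) MeasureTheory.volume 0 t := by
  -- A non-integrable function has integral `0` by convention, so a nonzero value proves
  -- integrability.
  refine intervalIntegral.intervalIntegrable_of_integral_ne_zero ?_
  rw [integral_rpow_mul_sub_rpow ha hb ht]
  have := Real.Gamma_pos_of_pos ha
  have := Real.Gamma_pos_of_pos hb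
  have := Real.Gamma_pos_of_pos (add_pos ha hb)
  positivity

section fracSeries

variable {α : ℝ} {m : ℕ → ℝ}

theorem hasDerivAt_fracSeries_rpow (hα : 0 < α) (hm : GeometricallyBounded m) {t : ℝ}
    (ht : 0 < t) :
    HasDerivAt (fun s => fracSeries α 1 m (s ^ α))
      (t ^ (α - 1) * fracSeries α α (fun n => m (n + 1)) (t ^ α)) t := by
  have := (hasDerivAt_fracSeries hα hm (t ^ α)).comp t (Real.hasDerivAt_rpow_const (p := α)
    (Or.inl ht.ne'))
  refine this.congr_deriv ?_
  field_simp

theorem intervalIntegrable_rpow_mul_fracSeries {δ b : ℝ} (hα : 0 < α) (hδ : 0 < δ) (hb : 0 < b)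
    (hm : GeometricallyBounded m) {t : ℝ} (ht : 0 < t) :
    IntervalIntegrable (fun s => s ^ (α - 1) * fracSeries α δ m (s ^ α) * (t - s) ^ (b - 1))
      MeasureTheory.volume 0 t := by
  have hc : Continuous fun s : ℝ => fracSeries α δ m (s ^ α) :=
    (continuous_fracSeries hα hδ hm).comp (Real.continuous_rpow_const hα.le)
  have := (intervalIntegrable_rpow_mul_sub_rpow hα hb ht).mul_continuousOn hc.continuousOn
  exact this.congr fun s _ => by ring

open MeasureTheory in
-- Termwise Beta integrals: each `Γ(n α + α)` cancels and the offset moves from `α` to `α + b`. The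
-- interchange holds because the `L¹` norms are the same Beta integrals with `|m n|`, hence
-- summable.
theorem integral_rpow_mul_fracSeries {b : ℝ} (hα : 0 < α) (hb : 0 < b)
    (hm : GeometricallyBounded m) {t : ℝ} (ht : 0 < t) :
    ∫ s in (0 : ℝ)..t, s ^ (α - 1) * fracSeries α α m (s ^ α) * (t - s) ^ (b - 1) =
      Real.Gamma b * (t ^ (α + b - 1) * fracSeries α (α + b) m (t ^ α)) := by
  have hn : ∀ n : ℕ, (0 : ℝ) < n * α + α := fun n => by positivity
  set F : ℕ → ℝ → ℝ := fun n s => m n / Real.Gamma (n * α + α) *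
    (s ^ (n * α + α - 1) * (t - s) ^ (b - 1)) with hF
  have hval : ∀ n : ℕ, ∫ s in Set.Ioc 0 t, s ^ (n * α + α - 1) * (t - s) ^ (b - 1) =
      t ^ (α + b - 1) * (t ^ α) ^ n *
        (Real.Gamma (n * α + α) * Real.Gamma b / Real.Gamma (n * α + (α + b))) := fun n => by
    rw [← intervalIntegral.integral_of_le ht.le, integral_rpow_mul_sub_rpow (hn n) hb ht,
      ← Real.rpow_natCast, ← Real.rpow_mul ht.le, ← Real.rpow_add ht]
    ring_nf
  have hint : ∀ n, Integrable (F n) (volume.restrict (Set.Ioc 0 t)) := fun n =>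
    ((intervalIntegrable_iff_integrableOn_Ioc_of_le ht.le).mp
      (intervalIntegrable_rpow_mul_sub_rpow (hn n) hb ht)).const_mul _
  have hnorm : ∀ n, ∫ s in Set.Ioc 0 t, ‖F n s‖ =
      |m n| / Real.Gamma (n * α + α) * (t ^ (α + b - 1) * (t ^ α) ^ n *
        (Real.Gamma (n * α + α) * Real.Gamma b / Real.Gamma (n * α + (α + b)))) := fun n => by
    rw [← hval, ← integral_const_mul]
    refine setIntegral_congr_fun measurableSet_Ioc fun s hs => ?_
    have h1 : 0 ≤ s ^ (n * α + α - 1) := Real.rpow_nonneg hs.1.le _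
    have h2 : 0 ≤ (t - s) ^ (b - 1) := Real.rpow_nonneg (sub_nonneg.mpr hs.2) _
    simp only [hF]
    rw [norm_mul, norm_div, norm_mul, Real.norm_of_nonneg h1, Real.norm_of_nonneg h2,
      Real.norm_of_nonneg (Real.Gamma_pos_of_pos (hn n)).le, Real.norm_eq_abs]
  have hG : ∀ n : ℕ, 0 < Real.Gamma (n * α + α) := fun n => Real.Gamma_pos_of_pos (hn n)
  have hsum : Summable fun n => ∫ s in Set.Ioc 0 t, ‖F n s‖ := by
    refine ((summable_norm_fracSeries hα (add_pos hα hb) hm (t ^ α)).mul_left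
      (Real.Gamma b * t ^ (α + b - 1))).congr fun n => ?_
    rw [hnorm, norm_div, norm_mul, Real.norm_eq_abs,
      Real.norm_of_nonneg (by positivity : (0 : ℝ) ≤ (t ^ α) ^ n),
      Real.norm_of_nonneg (Real.Gamma_pos_of_pos
        (by positivity : (0 : ℝ) < n * α + (α + b))).le]
    have := (hG n).ne'
    field_simp
  have key := integral_tsum_of_summable_integral_norm hint hsum
  rw [intervalIntegral.integral_of_le ht.le]
  calc ∫ s in Set.Ioc 0 t, s ^ (α - 1) * fracSeries α α m (s ^ α) * (t - s) ^ (b - 1)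
      = ∫ s in Set.Ioc 0 t, ∑' n, F n s := by
        refine setIntegral_congr_fun measurableSet_Ioc fun s hs => ?_
        simp only [hF, fracSeries]
        rw [← tsum_mul_left, ← tsum_mul_right]
        refine tsum_congr fun n => ?_
        rw [add_sub_assoc, Real.rpow_add hs.1, mul_comm (n : ℝ) α, Real.rpow_mul hs.1.le,
          Real.rpow_natCast]
        ring
    _ = _ := by
        rw [← key, fracSeries, ← tsum_mul_left, ← tsum_mul_left]
        refine tsum_congr fun n => ?_
        simp only [hF]
        rw [integral_const_mul, hval]
        have := (hG n).ne'
        field_simp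

/-- The derivative may blow up like `t ^ (α - 1)` at `0`, but it is integrable, so the function is
an indefinite integral plus a constant. -/
theorem absolutelyContinuousOnInterval_fracSeries_rpow (hα : 0 < α)
    (hm : GeometricallyBounded m) {T : ℝ} (hT : 0 ≤ T) :
    AbsolutelyContinuousOnInterval (fun s => fracSeries α 1 m (s ^ α)) 0 T := by
  rcases hT.eq_or_lt with rfl | hT
  · refine LipschitzOnWith.absolutelyContinuousOnInterval (K := 0) fun x hx y hy => ?_
    rw [Set.uIcc_self, Set.mem_singleton_iff] at hx hy
    simp [hx, hy]
  set g : ℝ → ℝ := fun s => s ^ (α - 1) * fracSeries α α (fun n => m (n + 1)) (s ^ α) with hg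
  have hint : ∀ t, 0 < t → IntervalIntegrable g MeasureTheory.volume 0 t := fun t ht => by
    simpa using intervalIntegrable_rpow_mul_fracSeries hα hα one_pos (hm.shift 1) ht
  have hc : Continuous fun s : ℝ => fracSeries α 1 m (s ^ α) :=
    (continuous_fracSeries hα one_pos hm).comp (Real.continuous_rpow_const hα.le)
  have h1 := (hint T hT).absolutelyContinuousOnInterval_intervalIntegral (c := 0) (by simp)
  have hconst : AbsolutelyContinuousOnInterval (fun _ : ℝ => fracSeries α 1 m ((0 : ℝ) ^ α)) 0 T :=
    LipschitzOnWith.absolutelyContinuousOnInterval (K := 0) fun x _ y _ => by simp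
  have h2 := h1.add hconst
  -- The two functions are shown to agree only on `[0, T]`, so the `ε`-`δ` condition is transferred
  -- instead of rewriting the function.
  refine (absolutelyContinuousOnInterval_iff _ _ _).mpr fun ε hε => ?_
  obtain ⟨δ, hδ, h⟩ := (absolutelyContinuousOnInterval_iff _ _ _).mp h2 ε hε
  have heq : ∀ t ∈ Set.uIcc 0 T, fracSeries α 1 m (t ^ α) =
      ((fun x => ∫ s in (0 : ℝ)..x, g s) + fun _ : ℝ => fracSeries α 1 m ((0 : ℝ) ^ α)) t := by
    intro t ht
    rw [Set.uIcc_of_le hT.le] at ht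
    rcases ht.1.eq_or_lt with rfl | ht0
    · simp
    · simp only [Pi.add_apply]
      rw [intervalIntegral.integral_eq_sub_of_hasDerivAt_of_le ht.1 hc.continuousOn
        (fun x hx => hasDerivAt_fracSeries_rpow hα hm hx.1) (hint t ht0)]
      ring
  refine ⟨δ, hδ, fun E hE hE' => ?_⟩
  refine lt_of_eq_of_lt (Finset.sum_congr rfl fun i hi => ?_) (h E hE hE')
  rw [heq _ (hE.1 i hi).1, heq _ (hE.1 i hi).2]

theorem caputoDerivExists_fracSeries_rpow {γ : ℝ} (hα : 0 < α) (hγ : γ ≤ 1)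
    (hm : GeometricallyBounded m) {t : ℝ} (ht : 0 < t) :
    CaputoDerivExists γ (fun s => fracSeries α 1 m (s ^ α)) t := by
  rw [CaputoDerivExists]
  split_ifs with h1
  · exact (hasDerivAt_fracSeries_rpow hα hm ht).differentiableAt
  · refine (intervalIntegrable_rpow_mul_fracSeries (δ := α) (b := 1 - γ) hα hα
      (sub_pos.mpr (lt_of_le_of_ne hγ h1)) (hm.shift 1) ht).congr fun s hs => ?_
    rw [Set.uIoc_of_le ht.le] at hs
    rw [(hasDerivAt_fracSeries_rpow hα hm hs.1).deriv, sub_sub_cancel_left,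
      Real.rpow_neg (sub_nonneg.mpr hs.2), div_eq_mul_inv]

/-- This is the Beta integral with `b = 1 - γ`. For `γ = α` the power of `t` disappears and the
offset is again `1`: the derivative just shifts the coefficients. -/
theorem caputoDeriv_fracSeries_rpow {γ : ℝ} (hα : 0 < α) (hγ : γ ≤ 1)
    (hm : GeometricallyBounded m) {t : ℝ} (ht : 0 < t) :
    caputoDeriv γ (fun s => fracSeries α 1 m (s ^ α)) t =
      t ^ (α - γ) * fracSeries α (α + 1 - γ) (fun n => m (n + 1)) (t ^ α) := by
  rw [caputoDeriv]
  split_ifs with h1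
  · rw [(hasDerivAt_fracSeries_rpow hα hm ht).deriv, h1, add_sub_cancel_right]
  · have hb : 0 < 1 - γ := sub_pos.mpr (lt_of_le_of_ne hγ h1)
    have h2 := integral_rpow_mul_fracSeries hα hb (hm.shift 1) ht
    rw [intervalIntegral.integral_congr_ae (g := fun s =>
      deriv (fun s => fracSeries α 1 m (s ^ α)) s / (t - s) ^ γ)] at h2
    · rw [h2, ← mul_assoc, one_div_mul_cancel (Real.Gamma_pos_of_pos hb).ne', one_mul]
      ring_nf
    · refine Filter.Eventually.of_forall fun s hs => ?_
      rw [Set.uIoc_of_le ht.le] at hs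
      rw [(hasDerivAt_fracSeries_rpow hα hm hs.1).deriv, sub_sub_cancel_left,
        Real.rpow_neg (sub_nonneg.mpr hs.2), div_eq_mul_inv]

end fracSeries

/-! ### Abel inversion of the Caputo derivative -/

/-- The two Beta parameters add up to `1`, so the value does not depend on `r` or `t`. -/
theorem integral_sub_rpow_mul_rpow {γ r t : ℝ} (hγ0 : 0 < γ) (hγ1 : γ < 1) (hrt : r < t) :
    ∫ s in r..t, (t - s) ^ (γ - 1) * (s - r) ^ (-γ) = Real.Gamma γ * Real.Gamma (1 - γ) := by
  have h := integral_rpow_mul_sub_rpow (sub_pos.mpr hγ1) hγ0 (sub_pos.mpr hrt)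
  have h2 := intervalIntegral.integral_comp_sub_right (a := r) (b := t)
    (fun u => u ^ (1 - γ - 1) * (t - r - u) ^ (γ - 1)) r
  rw [sub_self, h, sub_add_cancel, sub_self, Real.rpow_zero, one_mul, Real.Gamma_one, div_one] at h2
  rw [mul_comm, ← h2]
  refine intervalIntegral.integral_congr fun s _ => ?_
  simp only [sub_sub_sub_cancel_right, sub_sub_cancel_left]
  ring

open MeasureTheory in
/-- Composing Abel integrals of orders `1 - γ` and `γ` gives the ordinary integral. -/
theorem integral_sub_rpow_mul_integral {γ t : ℝ} (hγ0 : 0 < γ) (hγ1 : γ < 1) (ht : 0 < t)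
    {φ : ℝ → ℝ} (hφ : IntervalIntegrable φ volume 0 t) :
    ∫ s in (0 : ℝ)..t, (t - s) ^ (γ - 1) * ∫ r in (0 : ℝ)..s, φ r / (s - r) ^ γ =
      Real.Gamma γ * Real.Gamma (1 - γ) * ∫ r in (0 : ℝ)..t, φ r := by
  set μ := volume.restrict (Set.Ioo 0 t) with hμ
  have hφμ : Integrable φ μ := (intervalIntegrable_iff_integrableOn_Ioo_of_le ht.le).mp hφ
  -- Cutting the kernel off to `r < s` puts both iterated integrals on the square `(0, t)²`, ready
  -- for Fubini.
  set k : ℝ → ℝ → ℝ := fun s r =>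
    (Set.Ioi r).indicator (fun s => (t - s) ^ (γ - 1) * (s - r) ^ (-γ)) s with hk
  have hinter : ∀ r ∈ Set.Ioo 0 t, Set.Ioi r ∩ Set.Ioo 0 t = Set.Ioo r t := fun r hr => by
    ext s
    simp only [Set.mem_inter_iff, Set.mem_Ioi, Set.mem_Ioo]
    exact ⟨fun h => ⟨h.1, h.2.2⟩, fun h => ⟨h.1, hr.1.trans h.1, h.2⟩⟩
  have hB : Real.Gamma γ * Real.Gamma (1 - γ) ≠ 0 :=
    (mul_pos (Real.Gamma_pos_of_pos hγ0) (Real.Gamma_pos_of_pos (sub_pos.mpr hγ1))).ne'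
  have hkval : ∀ r ∈ Set.Ioo 0 t, ∫ s, k s r ∂μ = Real.Gamma γ * Real.Gamma (1 - γ) := by
    intro r hr
    rw [← integral_sub_rpow_mul_rpow hγ0 hγ1 hr.2, integral_indicator measurableSet_Ioi, hμ,
      Measure.restrict_restrict measurableSet_Ioi, hinter r hr,
      intervalIntegral.integral_of_le hr.2.le, integral_Ioc_eq_integral_Ioo]
  have hkint : ∀ r ∈ Set.Ioo 0 t, Integrable (fun s => k s r) μ := fun r hr =>
    not_imp_comm.mp integral_undef (by rw [hkval r hr]; exact hB)
  have hknn : ∀ s ∈ Set.Ioo 0 t, ∀ r, 0 ≤ k s r := fun s hs r => by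
    refine Set.indicator_apply_nonneg fun h => ?_
    exact mul_nonneg (Real.rpow_nonneg (sub_nonneg.mpr hs.2.le) _)
      (Real.rpow_nonneg (sub_nonneg.mpr (le_of_lt h)) _)
  have hmeas : AEStronglyMeasurable (Function.uncurry fun s r => k s r * φ r) (μ.prod μ) := by
    have h1 : Measurable (Function.uncurry k) := by
      have : Function.uncurry k = Set.indicator {p : ℝ × ℝ | p.2 < p.1}
          (fun p => (t - p.1) ^ (γ - 1) * (p.1 - p.2) ^ (-γ)) := by
        ext p
        rfl
      rw [this]
      exact Measurable.indicator (by fun_prop) (measurableSet_lt measurable_snd measurable_fst)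
    exact h1.aestronglyMeasurable.mul (hφμ.aestronglyMeasurable.comp_snd)
  -- Tonelli: integrating the absolute value over `s` first leaves a constant times `|φ r|`.
  have hint : Integrable (Function.uncurry fun s r => k s r * φ r) (μ.prod μ) := by
    rw [integrable_prod_iff' hmeas]
    constructor
    · filter_upwards [ae_restrict_mem measurableSet_Ioo] with r hr
      exact (hkint r hr).mul_const (φ r)
    · refine (hφμ.norm.const_mul (Real.Gamma γ * Real.Gamma (1 - γ))).congr ?_
      filter_upwards [ae_restrict_mem measurableSet_Ioo] with r hr
      rw [← hkval r hr, ← integral_mul_const]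
      refine setIntegral_congr_fun measurableSet_Ioo fun s hs => ?_
      simp only [Function.uncurry_apply_pair]
      rw [norm_mul, Real.norm_of_nonneg (hknn s hs r)]
  calc ∫ s in (0 : ℝ)..t, (t - s) ^ (γ - 1) * ∫ r in (0 : ℝ)..s, φ r / (s - r) ^ γ
      = ∫ s, ∫ r, k s r * φ r ∂μ ∂μ := by
        rw [intervalIntegral.integral_of_le ht.le, integral_Ioc_eq_integral_Ioo]
        refine setIntegral_congr_fun measurableSet_Ioo fun s hs => ?_
        have : ∀ r, k s r * φ r = (Set.Iio s).indicator
            (fun r => (t - s) ^ (γ - 1) * (s - r) ^ (-γ) * φ r) r := fun r => by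
          by_cases h : r < s
          · simp [hk, h]
          · simp [hk, h]
        simp only [this]
        rw [integral_indicator measurableSet_Iio, hμ,
          Measure.restrict_restrict measurableSet_Iio,
          show Set.Iio s ∩ Set.Ioo 0 t = Set.Ioo 0 s by
            ext r
            simp only [Set.mem_inter_iff, Set.mem_Iio, Set.mem_Ioo]
            exact ⟨fun h => ⟨h.2.1, h.1⟩, fun h => ⟨h.2, h.1, h.2.trans hs.2⟩⟩,
          intervalIntegral.integral_of_le hs.1.le, integral_Ioc_eq_integral_Ioo,
          ← integral_const_mul]
        refine setIntegral_congr_fun measurableSet_Ioo fun r hr => ?_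
        rw [Real.rpow_neg (sub_nonneg.mpr hr.2.le)]
        ring
    _ = ∫ r, ∫ s, k s r * φ r ∂μ ∂μ := integral_integral_swap hint
    _ = _ := by
        rw [intervalIntegral.integral_of_le ht.le, integral_Ioc_eq_integral_Ioo,
          ← integral_const_mul]
        refine setIntegral_congr_fun measurableSet_Ioo fun r hr => ?_
        rw [integral_mul_const, hkval r hr]

/-- Apply the composition of Abel integrals to `φ = deriv f`, which is integrable with integral `f t
- f 0` by absolute continuity. -/
theorem AbsolutelyContinuousOnInterval.sub_eq_integral_caputoDeriv {γ t : ℝ} (hγ0 : 0 < γ)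
    (hγ1 : γ ≤ 1) (ht : 0 < t) {f : ℝ → ℝ} (hf : AbsolutelyContinuousOnInterval f 0 t) :
    f t - f 0 =
      1 / Real.Gamma γ * ∫ s in (0 : ℝ)..t, (t - s) ^ (γ - 1) * caputoDeriv γ f s := by
  rcases hγ1.eq_or_lt with rfl | hγ1
  · simp [caputoDeriv, hf.integral_deriv_eq_sub]
  · have h := integral_sub_rpow_mul_integral hγ0 hγ1 ht hf.intervalIntegrable_deriv
    have h1 := (Real.Gamma_pos_of_pos hγ0).ne'
    have h2 := (Real.Gamma_pos_of_pos (sub_pos.mpr hγ1)).ne'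
    simp only [caputoDeriv, if_neg hγ1.ne, mul_left_comm _ (1 / Real.Gamma (1 - γ))]
    rw [intervalIntegral.integral_const_mul, h, hf.integral_deriv_eq_sub]
    field_simp

/-! ### Uniqueness through a weighted norm -/

theorem intervalIntegrable_sub_rpow_mul {γ t : ℝ} (hγ : 0 < γ) (ht : 0 < t) {g : ℝ → ℝ}
    (hg : ContinuousOn g (Set.Icc 0 t)) :
    IntervalIntegrable (fun s => (t - s) ^ (γ - 1) * g s) MeasureTheory.volume 0 t := by
  have h := intervalIntegrable_rpow_mul_sub_rpow one_pos hγ ht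
  simp only [sub_self, Real.rpow_zero, one_mul] at h
  exact h.mul_continuousOn (by rwa [Set.uIcc_of_le ht.le])

open MeasureTheory in
-- Substitute `u = t - s` and extend the integral to `(0, ∞)`. The factor `ρ ^ (-γ)` makes Abel
-- operators small in the weighted norm.
theorem integral_sub_rpow_mul_exp_le {γ t ρ : ℝ} (hγ : 0 < γ) (ht : 0 < t) (hρ : 0 < ρ) :
    ∫ s in (0 : ℝ)..t, (t - s) ^ (γ - 1) * Real.exp (ρ * s) ≤
      Real.exp (ρ * t) * (Real.Gamma γ / ρ ^ γ) := by
  have h1 := Real.integral_rpow_mul_exp_neg_mul_Ioi hγ hρ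
  have hpos : 0 < (1 / ρ) ^ γ * Real.Gamma γ := by
    have := Real.Gamma_pos_of_pos hγ
    positivity
  have hint : IntegrableOn (fun u : ℝ => u ^ (γ - 1) * Real.exp (-(ρ * u))) (Set.Ioi 0) :=
    not_imp_comm.mp integral_undef (by rw [h1]; exact hpos.ne')
  have h2 := intervalIntegral.integral_comp_sub_left (a := 0) (b := t)
    (fun u => Real.exp (ρ * t) * (u ^ (γ - 1) * Real.exp (-(ρ * u)))) t
  have h3 : ∫ s in (0 : ℝ)..t, (t - s) ^ (γ - 1) * Real.exp (ρ * s) =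
      ∫ s in (0 : ℝ)..t,
        Real.exp (ρ * t) * ((t - s) ^ (γ - 1) * Real.exp (-(ρ * (t - s)))) := by
    refine intervalIntegral.integral_congr fun s _ => ?_
    have : Real.exp (ρ * s) = Real.exp (ρ * t) * Real.exp (-(ρ * (t - s))) := by
      rw [← Real.exp_add]
      ring_nf
    simp only [this]
    ring
  rw [h3, h2, sub_self, sub_zero, intervalIntegral.integral_const_mul,
    intervalIntegral.integral_of_le ht.le]
  refine mul_le_mul_of_nonneg_left ?_ (Real.exp_pos _).le
  calc _ ≤ ∫ u in Set.Ioi 0, u ^ (γ - 1) * Real.exp (-(ρ * u)) := by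
        refine setIntegral_mono_set hint ?_
          (Filter.Eventually.of_forall fun x hx => hx.1)
        filter_upwards [ae_restrict_mem measurableSet_Ioi] with x hx
        have : (0 : ℝ) < x := hx
        simp only [Pi.zero_apply]
        positivity
    _ = _ := by
        rw [h1, one_div, Real.inv_rpow hρ.le]
        field_simp

theorem Matrix.abs_mulVec_apply_le {ι : Type*} [Fintype ι] (A : Matrix ι ι ℝ) (v : ι → ℝ) (i : ι) :
    |A.mulVec v i| ≤ (∑ i, ∑ j, |A i j|) * ‖v‖ := by
  calc |A.mulVec v i| ≤ ∑ j, |A i j * v j| := Finset.abs_sum_le_sum_abs _ _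
    _ ≤ ∑ j, |A i j| * ‖v‖ := by
        refine Finset.sum_le_sum fun j _ => ?_
        rw [abs_mul]
        exact mul_le_mul_of_nonneg_left (norm_le_pi_norm v j) (abs_nonneg _)
    _ = (∑ j, |A i j|) * ‖v‖ := (Finset.sum_mul _ _ _).symm
    _ ≤ _ := by
        refine mul_le_mul_of_nonneg_right ?_ (norm_nonneg _)
        exact Finset.single_le_sum (f := fun i => ∑ j, |A i j|)
          (fun i _ => Finset.sum_nonneg fun j _ => abs_nonneg _) (Finset.mem_univ i)

/-- A linear homogeneous system of Abel integral equations of positive orders has only the zero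
solution. -/
theorem eq_zero_of_abel_system {ι : Type*} [Fintype ι] {γ : ι → ℝ} (hγ : ∀ i, 0 < γ i)
    (A : Matrix ι ι ℝ) {d : ℝ → ι → ℝ} {T : ℝ} (hT : 0 ≤ T) (hc : ContinuousOn d (Set.Icc 0 T))
    (h0 : d 0 = 0)
    (h : ∀ i, ∀ t ∈ Set.Ioc 0 T, d t i =
      1 / Real.Gamma (γ i) * ∫ s in (0 : ℝ)..t, (t - s) ^ (γ i - 1) * A.mulVec (d s) i) :
    ∀ t ∈ Set.Icc 0 T, d t = 0 := by
  set L : ℝ := ∑ i, ∑ j, |A i j| with hL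
  have hL0 : 0 ≤ L := Finset.sum_nonneg fun i _ => Finset.sum_nonneg fun j _ => abs_nonneg _
  -- This `ρ` gives the integral operator norm at most `1 / 2` for the weight `exp (-(ρ * t))`.
  obtain ⟨ρ, hρ0, hρ⟩ : ∃ ρ : ℝ, 0 < ρ ∧ ∀ i, 2 * L ≤ ρ ^ γ i :=
    ((Filter.eventually_gt_atTop 0).and (Filter.eventually_all.mpr fun i =>
      (tendsto_rpow_atTop (hγ i)).eventually_ge_atTop (2 * L))).exists
  have hwc : ContinuousOn (fun t => Real.exp (-(ρ * t)) * ‖d t‖) (Set.Icc 0 T) :=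
    (by fun_prop : Continuous fun t => Real.exp (-(ρ * t))).continuousOn.mul hc.norm
  obtain ⟨t₀, ht₀, hmax⟩ := isCompact_Icc.exists_isMaxOn (Set.nonempty_Icc.mpr hT) hwc
  set W := Real.exp (-(ρ * t₀)) * ‖d t₀‖ with hW
  have hW0 : 0 ≤ W := by positivity
  have hexp : ∀ t, Real.exp (ρ * t) * Real.exp (-(ρ * t)) = 1 := fun t => by
    rw [← Real.exp_add, add_neg_cancel, Real.exp_zero]
  have hbound : ∀ t ∈ Set.Icc 0 T, ‖d t‖ ≤ W * Real.exp (ρ * t) := fun t ht => by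
    have h1 : Real.exp (-(ρ * t)) * ‖d t‖ ≤ W := hmax ht
    calc ‖d t‖ = Real.exp (-(ρ * t)) * ‖d t‖ * Real.exp (ρ * t) := by
          linear_combination -‖d t‖ * hexp t
      _ ≤ _ := mul_le_mul_of_nonneg_right h1 (Real.exp_pos _).le
  -- The integral equation at the maximum point `t₀` improves the bound by the factor `1 / 2`, so
  -- the maximum is `0`.
  have hhalf : ‖d t₀‖ ≤ W / 2 * Real.exp (ρ * t₀) := by
    rcases ht₀.1.eq_or_lt with h1 | h1
    · rw [← h1, h0, norm_zero]
      positivity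
    refine (pi_norm_le_iff_of_nonneg (by positivity)).mpr fun i => ?_
    have hG := Real.Gamma_pos_of_pos (hγ i)
    have hρi : 0 < ρ ^ γ i := by positivity
    have hle : ‖∫ s in (0 : ℝ)..t₀, (t₀ - s) ^ (γ i - 1) * A.mulVec (d s) i‖ ≤
        ∫ s in (0 : ℝ)..t₀, L * W * ((t₀ - s) ^ (γ i - 1) * Real.exp (ρ * s)) := by
      refine intervalIntegral.norm_integral_le_of_norm_le h1.le
        (Filter.Eventually.of_forall fun s hs => ?_)
        ((intervalIntegrable_sub_rpow_mul (hγ i) h1 (by fun_prop)).const_mul _)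
      have h2 : 0 ≤ (t₀ - s) ^ (γ i - 1) := Real.rpow_nonneg (sub_nonneg.mpr hs.2) _
      rw [norm_mul, Real.norm_of_nonneg h2, mul_left_comm]
      refine mul_le_mul_of_nonneg_left ?_ h2
      calc ‖A.mulVec (d s) i‖ ≤ L * ‖d s‖ := A.abs_mulVec_apply_le (d s) i
        _ ≤ L * (W * Real.exp (ρ * s)) :=
          mul_le_mul_of_nonneg_left (hbound s ⟨hs.1.le, hs.2.trans ht₀.2⟩) hL0
        _ = _ := by ring
    rw [intervalIntegral.integral_const_mul] at hle
    rw [h i t₀ ⟨h1, ht₀.2⟩, norm_mul, Real.norm_of_nonneg (by positivity)]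
    calc 1 / Real.Gamma (γ i) * ‖∫ s in (0 : ℝ)..t₀, (t₀ - s) ^ (γ i - 1) * A.mulVec (d s) i‖
        ≤ 1 / Real.Gamma (γ i) *
          (L * W * (Real.exp (ρ * t₀) * (Real.Gamma (γ i) / ρ ^ γ i))) := by
          refine mul_le_mul_of_nonneg_left (hle.trans ?_) (by positivity)
          exact mul_le_mul_of_nonneg_left (integral_sub_rpow_mul_exp_le (hγ i) h1 hρ0)
            (by positivity)
      _ = L / ρ ^ γ i * (W * Real.exp (ρ * t₀)) := by field_simp
      _ ≤ 1 / 2 * (W * Real.exp (ρ * t₀)) := by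
          refine mul_le_mul_of_nonneg_right ?_ (by positivity)
          rw [div_le_div_iff₀ hρi two_pos]
          linarith [hρ i]
      _ = _ := by ring
  have hWz : W = 0 := by
    have h1 : W ≤ W / 2 := by
      calc W ≤ Real.exp (-(ρ * t₀)) * (W / 2 * Real.exp (ρ * t₀)) :=
            mul_le_mul_of_nonneg_left hhalf (Real.exp_pos _).le
        _ = W / 2 := by linear_combination W / 2 * hexp t₀
    linarith
  intro t ht
  have := hbound t ht
  rw [hWz, zero_mul] at this
  exact norm_le_zero_iff.mp this

namespace IsMixedIndexSolution

variable {γ : Fin 2 → ℝ} {A : Matrix (Fin 2) (Fin 2) ℝ} {z : Fin 2 → ℝ} {x y : ℝ → Fin 2 → ℝ}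

theorem eq_add_integral (hγ0 : ∀ i, 0 < γ i) (hγ1 : ∀ i, γ i ≤ 1)
    (hy : IsMixedIndexSolution γ A z y) (i : Fin 2) {t : ℝ} (ht : 0 < t) :
    y t i = z i +
      1 / Real.Gamma (γ i) * ∫ s in (0 : ℝ)..t, (t - s) ^ (γ i - 1) * A.mulVec (y s) i := by
  have h := (hy.absolutelyContinuous i t ht.le).sub_eq_integral_caputoDeriv (hγ0 i) (hγ1 i) ht
  have h2 : ∫ s in (0 : ℝ)..t, (t - s) ^ (γ i - 1) * caputoDeriv (γ i) (fun s => y s i) s =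
      ∫ s in (0 : ℝ)..t, (t - s) ^ (γ i - 1) * A.mulVec (y s) i := by
    refine intervalIntegral.integral_congr_ae (Filter.Eventually.of_forall fun s hs => ?_)
    rw [Set.uIoc_of_le ht.le] at hs
    rw [hy.equation i s hs.1]
  rw [← h2, ← h, hy.initial]
  ring

theorem continuousOn (hy : IsMixedIndexSolution γ A z y) {T : ℝ} (hT : 0 ≤ T) :
    ContinuousOn y (Set.Icc 0 T) :=
  continuousOn_pi.mpr fun i => by
    simpa [Set.uIcc_of_le hT] using (hy.absolutelyContinuous i T hT).continuousOn

/-- Subtracting the two integral equations cancels `z` and leaves the homogeneous Abel system for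
the difference. -/
theorem eqOn (hγ0 : ∀ i, 0 < γ i) (hγ1 : ∀ i, γ i ≤ 1)
    (hx : IsMixedIndexSolution γ A z x) (hy : IsMixedIndexSolution γ A z y) {t : ℝ} (ht : 0 ≤ t) :
    x t = y t := by
  refine sub_eq_zero.mp (eq_zero_of_abel_system hγ0 A (d := fun t => x t - y t) ht
    ((hx.continuousOn ht).sub (hy.continuousOn ht)) (by simp [hx.initial, hy.initial])
    (fun i s hs => ?_) t ⟨ht, le_rfl⟩)
  have hAc : ∀ u : ℝ → Fin 2 → ℝ, IsMixedIndexSolution γ A z u →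
      ContinuousOn (fun r => A.mulVec (u r) i) (Set.Icc 0 s) := fun u hu =>
    (by fun_prop : Continuous fun v => A.mulVec v i).comp_continuousOn (hu.continuousOn hs.1.le)
  simp only [Pi.sub_apply, Matrix.mulVec_sub, mul_sub]
  rw [hx.eq_add_integral hγ0 hγ1 i hs.1, hy.eq_add_integral hγ0 hγ1 i hs.1,
    intervalIntegral.integral_sub
      (intervalIntegrable_sub_rpow_mul (hγ0 i) hs.1 (hAc x hx))
      (intervalIntegrable_sub_rpow_mul (hγ0 i) hs.1 (hAc y hy))]
  ring

end IsMixedIndexSolution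

/-! ### The Mittag-Leffler sum as the solution -/

theorem summable_mittagLeffler {α : ℝ} (hα : 0 < α) (w : ℂ) :
    Summable fun n : ℕ => w ^ n / ((Real.Gamma (1 + (n : ℝ) * α) : ℝ) : ℂ) := by
  have hm : GeometricallyBounded fun _ => 1 := ⟨1, 1, zero_le_one, zero_le_one, fun n => by simp⟩
  refine Summable.of_norm ((summable_norm_fracSeries hα one_pos hm ‖w‖).congr fun n => ?_)
  rw [one_mul, norm_div, norm_div, norm_pow, norm_pow, norm_norm, Complex.norm_real,
    add_comm (1 : ℝ)]

theorem geometricallyBounded_moment {ι : Type*} [Fintype ι] {lam c : ι → ℂ} {m : ℕ → ℝ}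
    (hm : ∀ n, ∑ j, c j * lam j ^ n = (m n : ℂ)) : GeometricallyBounded m := by
  refine ⟨∑ j, ‖c j‖, ∑ j, ‖lam j‖, Finset.sum_nonneg fun _ _ => norm_nonneg _,
    Finset.sum_nonneg fun _ _ => norm_nonneg _, fun n => ?_⟩
  rw [← Real.norm_eq_abs, ← Complex.norm_real, ← hm, Finset.sum_mul]
  refine (norm_sum_le _ _).trans (Finset.sum_le_sum fun j _ => ?_)
  rw [norm_mul, norm_pow]
  have : ‖lam j‖ ≤ ∑ j, ‖lam j‖ :=
    Finset.single_le_sum (fun j _ => norm_nonneg (lam j)) (Finset.mem_univ j)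
  gcongr

theorem fracSeries_moment_eq_sum_mittagLeffler {ι : Type*} [Fintype ι] {α : ℝ} (hα : 0 < α)
    {lam c : ι → ℂ} {m : ℕ → ℝ} (hm : ∀ n, ∑ j, c j * lam j ^ n = (m n : ℂ)) (x : ℝ) :
    (fracSeries α 1 m x : ℂ) = ∑ j, c j * mittagLeffler α (lam j * (x : ℂ)) := by
  simp only [mittagLeffler, ← tsum_mul_left]
  rw [← Summable.tsum_finsetSum fun j _ => (summable_mittagLeffler hα _).mul_left (c j),
    fracSeries, Complex.ofReal_tsum]
  refine tsum_congr fun n => ?_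
  push_cast
  rw [← hm, Finset.sum_mul, Finset.sum_div]
  refine Finset.sum_congr rfl fun j _ => ?_
  rw [add_comm (1 : ℝ), mul_pow]
  ring

theorem IsRootList.isMixedIndexSolution_fracSeries {α : ℝ} (hα : 0 < α) {K : ℕ} (hK : 0 < K)
    (hβ : (K : ℝ) * α ≤ 1) {A : Matrix (Fin 2) (Fin 2) ℝ} {z : Fin 2 → ℝ}
    {lam : Fin (K + 1) → ℂ} {c : Fin (K + 1) → Fin 2 → ℂ} (h : IsRootList A K lam)
    (hc : IsPartialFraction A z K lam c) {m : ℕ → Fin 2 → ℝ}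
    (hm : ∀ n i, ∑ j, c j i * lam j ^ n = (m n i : ℂ)) :
    IsMixedIndexSolution ![α, (K : ℝ) * α] A z
      (fun t i => fracSeries α 1 (fun n => m n i) (t ^ α)) := by
  have hg : ∀ i, GeometricallyBounded fun n => m n i := fun i =>
    geometricallyBounded_moment fun n => hm n i
  have hα1 : α ≤ 1 := le_trans (le_mul_of_one_le_left hα.le (by exact_mod_cast hK)) hβ
  have hγ : ∀ i, (![α, (K : ℝ) * α] : Fin 2 → ℝ) i ≤ 1 := fun i => by
    fin_cases i
    · exact hα1
    · exact hβ
  have hz : ∀ i, m 0 i = z i := fun i => by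
    fin_cases i
    · exact Complex.ofReal_injective ((hm 0 0).symm.trans (h.moment_fst_zero hK hc))
    · exact Complex.ofReal_injective ((hm 0 1).symm.trans (h.moment_snd_of_lt hK hc hK))
  have hfst : ∀ n, m (n + 1) 0 = A 0 0 * m n 0 + A 0 1 * m n 1 := fun n => by
    have := h.moment_fst_succ hK hc n
    rw [hm, hm, hm] at this
    exact_mod_cast this
  have hsnd : ∀ n, m (n + K) 1 = A 1 0 * m n 0 + A 1 1 * m n 1 := fun n => by
    have := h.moment_snd_add hK hc n
    rw [hm, hm, hm] at this
    exact_mod_cast this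
  have hsnd0 : ∀ n, n + 1 < K → m (n + 1) 1 = 0 := fun n hn => by
    have := h.moment_snd_of_lt hK hc hn
    rw [hm, if_neg n.succ_ne_zero] at this
    exact_mod_cast this
  refine ⟨?_, fun i T hT => absolutelyContinuousOnInterval_fracSeries_rpow hα (hg i) hT,
    fun i t ht => caputoDerivExists_fracSeries_rpow hα (hγ i) (hg i) ht, fun i t ht => ?_⟩
  · funext i
    rw [Real.zero_rpow hα.ne', fracSeries, tsum_eq_single 0 fun n hn => by simp [hn]]
    simp [hz]
  rw [caputoDeriv_fracSeries_rpow hα (hγ i) (hg i) ht]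
  fin_cases i
  -- Here `γ = α`, so the shifted series is rewritten directly by the recursion.
  · simp only [Fin.zero_eta, Matrix.cons_val_zero, hfst, sub_self, Real.rpow_zero, one_mul,
      add_sub_cancel_left, fracSeries_add_mul hα one_pos (hg 0) (hg 1), Matrix.mulVec,
      Matrix.vec2_dotProduct]
  -- Here `K = k + 1`. After the shift the first `k` coefficients vanish; the extracted `(t ^ α) ^
  -- k` cancels `t ^ (α - K α)` and the offset returns to `1`.
  · obtain ⟨k, rfl⟩ := Nat.exists_eq_add_one.mpr hK
    simp only [Fin.mk_one, Matrix.cons_val_one, Matrix.cons_val_fin_one, Matrix.mulVec,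
      Matrix.vec2_dotProduct]
    rw [fracSeries_eq_pow_mul hα (by linarith) ((hg 1).shift 1) (k := k)
      fun n hn => hsnd0 n (by omega)]
    have h1 : α + 1 - ((k + 1 : ℕ) : ℝ) * α + k * α = 1 := by push_cast; ring
    have h2 : t ^ (α - ((k + 1 : ℕ) : ℝ) * α) * (t ^ α) ^ k = 1 := by
      rw [← Real.rpow_mul_natCast ht.le, ← Real.rpow_add ht, ← Real.rpow_zero t]
      congr 1
      push_cast
      ring
    rw [← mul_assoc, h2, one_mul, h1, ← fracSeries_add_mul hα one_pos (hg 0) (hg 1)]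
    simp only [add_assoc, hsnd]

theorem corollary16 (α : ℝ) (hα_rat : ∃ r : ℚ, (r : ℝ) = α) (hα_pos : 0 < α)
    (K : ℕ) (hK : 0 < K) (hβ : (K : ℝ) * α ≤ 1)
    (A : Matrix (Fin 2) (Fin 2) ℝ) (z : Fin 2 → ℝ) :
    (∃ lam : Fin (K + 1) → ℂ, IsRootList A K lam) ∧
    ∀ lam : Fin (K + 1) → ℂ, IsRootList A K lam →
      (Function.Injective lam →
        ∃! c : Fin (K + 1) → Fin 2 → ℂ, IsPartialFraction A z K lam c) ∧
      ∀ c : Fin (K + 1) → Fin 2 → ℂ, IsPartialFraction A z K lam c →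
        (∃ y : ℝ → Fin 2 → ℝ, IsMixedIndexSolution ![α, (K : ℝ) * α] A z y) ∧
        ∀ y : ℝ → Fin 2 → ℝ, IsMixedIndexSolution ![α, (K : ℝ) * α] A z y →
          ∀ t : ℝ, 0 ≤ t → ∀ i : Fin 2,
            (y t i : ℂ) =
              ∑ j : Fin (K + 1), c j i * mittagLeffler α (lam j * ((t ^ α : ℝ) : ℂ)) := by
  refine ⟨exists_isRootList A hK, fun lam hlam =>
    ⟨hlam.existsUnique_isPartialFraction, fun c hc => ?_⟩⟩
  -- Real moments make the complex sum a real-valued candidate solution.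
  choose m hm using hlam.exists_real_moment hK hc
  have hsol := hlam.isMixedIndexSolution_fracSeries hα_pos hK hβ hc hm
  refine ⟨⟨_, hsol⟩, fun y hy t ht i => ?_⟩
  have hα1 : α ≤ 1 := le_trans (le_mul_of_one_le_left hα_pos.le (by exact_mod_cast hK)) hβ
  have hK' : (0 : ℝ) < K := by exact_mod_cast hK
  rw [hy.eqOn (fun i => ?_) (fun i => ?_) hsol ht]
  · exact fracSeries_moment_eq_sum_mittagLeffler hα_pos (fun n => hm n i) (t ^ α)
  · fin_cases i
    · exact hα_pos
    · exact mul_pos hK' hα_pos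
  · fin_cases i
    · exact hα1
    · exact hβ
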